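/- Let $u=(u^1,u^2,u^3)$ be local coordinates (real, $C^\infty$ setting) and $P_0^{(5)}=\mathrm{diag}(d_x,d_x,0)$, $d_x=\frac{d}{dx}$. A (homogeneous) deformation of $P_0^{(5)}$ modulo $\epsilon^2$ is $P_\epsilon=P_0^{(5)}+\epsilon P_1+O(\epsilon^2)$ with $P_1^{ij}=A^{ij}(u)d_x^2+B^{ij}_k(u)u^k_x d_x+C^{ij}_k(u)u^k_{xx}+D^{ij}_{rk}(u)u^r_xu^k_x$ skew-adjoint and $[P_\epsilon,P_\epsilon]=O(\epsilon^2)$ for the Schouten bracket. Modulo $\epsilon^2$, a Miura transformation between such deformations consists of a local diffeomorphism $v=\Phi(u)$ with Jacobian $J$ and $JP_0^{(5)}J^t=P_0^{(5)}$, and a vector field $X^i=X^i_k(u)u^k_x$; it maps $P_1$ to $J(P_1+\mathrm{Lie}_XP_0^{(5)})J^t$. It is infinitesimal if $\Phi=\mathrm{id}$. For functions $b,e^{ij},c^{ij}$ ($i>j$) of $u^3$ let $$N(b,e,c)=\begin{pmatrix}0&0&0\\0&0&0\\0&0&b\,u^3_x\end{pmatrix}d_x+\begin{pmatrix}0&-\gamma^{21}&-\gamma^{31}\\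 \gamma^{21}&0&-\gamma^{32}\\ \gamma^{31}&\gamma^{32}&\tfrac12(b\,u^3_x)_x\end{pmatrix},\qquad \gamma^{ij}=e^{ij}(u^3_x)^2+c^{ij}u^3_{xx}.$$ Consider deformations which infinitesimal Miura transformations bring to the form $P_1=N(b,e,c)$ with $b=0$, in the generic case where all $e^{ij},c^{ij}$ ($i>j$) are nowhere zero. Up to Miura transformations, these deformations depend on $3$ functions of $u^3$. Precisely, for $h=(h_1,h_2,h_3)$ with $h_i$ smooth functions of $u^3$ and $h_2,h_3$ nowhere zero, let $N_h$ be $N(b,e,c)$ with $b=e^{21}=c^{21}=e^{31}=0$, $e^{32}=h_1$, $c^{31}=h_2$, $c^{32}=h_3$. Then: 1. near every point, each of these deformations is mapped by a Miura transformation to $P_0^{(5)}+\epsilon N_h+O(\epsilon^2)$ for some such $h$; 2. for every such $h$, $P_0^{(5)}+\epsilon N_h+O(\epsilon^2)$ is a deformation, and near every point a Miura transformation maps it to $P_0^{(5)}+\epsilon N(0,e,c)+O(\epsilon^2)$ with all $e^{ij},c^{ij}$ nowhere zero; 3. the remaining freedom consists of finitely many constants: if two Miura transformations, with leading terms $\Phi$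 and $\Psi$ defined near $p$, map $N_h$ to $N_f$ and to $N_g$ respectively, and $\Phi(p)=\Psi(p)$, $d\Phi_p=d\Psi_p$, then $f_i=g_i$ near the third coordinate of $\Phi(p)$, for $i=1,2,3$. -/

import Mathlib

open scoped ContDiff Matrix Topology

namespace DegPoisson

/-- The coordinate space of `u = (u¹, u², u³)`; the paper's index `i` is `i - 1 : Fin 3`. -/
abbrev E3 : Type := Fin 3 → ℝ

/-- A (`u`-dependent) matrix differential operator in `d/dx`, given by its action: the field
`u : x ↦ u(x)` and the covector field `ξ : x ↦ ξ(x)` are sent to the vector field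
`x ↦ (P[u] ξ)(x)`. -/
abbrev Op : Type := (ℝ → E3) → (ℝ → E3) → (ℝ → E3)

/-- Smooth fields `x ↦ u(x)` with values in the coordinate domain `U`. -/
def IsField (U : Set E3) (u : ℝ → E3) : Prop :=
  ContDiff ℝ ∞ u ∧ ∀ x, u x ∈ U

/-- Equality of two operators over the coordinate domain `U`. -/
def OpEqOn (U : Set E3) (P Q : Op) : Prop :=
  ∀ u ξ : ℝ → E3, IsField U u → ContDiff ℝ ∞ ξ → P u ξ = Q u ξ

/-- The undeformed structure `diag(d/dx, d/dx, 0)`. -/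
noncomputable def P0 : Op := fun _ ξ x => ![deriv ξ x 0, deriv ξ x 1, 0]

/-- Homogeneous operators of degree two (the possible first-order terms `P₁`):
`P₁^{ij} = A^{ij}(u) d²/dx² + B^{ij}_k(u) u^k_x d/dx + C^{ij}_k(u) u^k_{xx}
  + D^{ij}_{rk}(u) u^r_x u^k_x`, with coefficients smooth on `U`. -/
def IsHomogeneousTwo (U : Set E3) (P : Op) : Prop :=
  ∃ (A : E3 → Fin 3 → Fin 3 → ℝ) (B C : E3 → Fin 3 → Fin 3 → Fin 3 → ℝ)
    (D : E3 → Fin 3 → Fin 3 → Fin 3 → Fin 3 → ℝ),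
    ContDiffOn ℝ ∞ A U ∧ ContDiffOn ℝ ∞ B U ∧ ContDiffOn ℝ ∞ C U ∧ ContDiffOn ℝ ∞ D U ∧
    OpEqOn U P (fun u ξ x i => ∑ j,
      (A (u x) i j * deriv (deriv ξ) x j
        + (∑ k, B (u x) i j k * deriv u x k) * deriv ξ x j
        + (∑ k, C (u x) i j k * deriv (deriv u) x k) * ξ x j
        + (∑ r, ∑ k, D (u x) i j r k * deriv u x r * deriv u x k) * ξ x j))

/-- Skew-adjointness `P* = -P`, tested on compactly supported covector fields. -/
def IsSkew (U : Set E3) (P : Op) : Prop :=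
  ∀ u ξ η : ℝ → E3, IsField U u → ContDiff ℝ ∞ ξ → ContDiff ℝ ∞ η →
    HasCompactSupport ξ → HasCompactSupport η →
    ∫ x, ξ x ⬝ᵥ P u η x = - ∫ x, P u ξ x ⬝ᵥ η x

/-- Variation of the operator `P` at `u` in the direction `Y`:
`(d/ds) P[u + sY] ξ` at `s = 0`. -/
noncomputable def variation (P : Op) (u Y ξ : ℝ → E3) : ℝ → E3 :=
  fun x i => deriv (fun s : ℝ => P (u + s • Y) ξ x i) 0

/-- One term of the Schouten bracket of two skew-adjoint operators. -/
noncomputable def schoutenTerm (P Q : Op) (u ξ η ζ : ℝ → E3) : ℝ :=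
  ∫ x, ξ x ⬝ᵥ (variation P u (Q u η) ζ x + variation Q u (P u η) ζ x)

/-- Schouten bracket `[P, Q]` of two skew-adjoint operators (as a trivector: the cyclic sum).
For the bracket `{F, G} = ∫ δF P δG`, the condition `[P, P] = 0` is the Jacobi identity. -/
noncomputable def schouten (P Q : Op) (u ξ η ζ : ℝ → E3) : ℝ :=
  schoutenTerm P Q u ξ η ζ + schoutenTerm P Q u η ζ ξ + schoutenTerm P Q u ζ ξ η

/-- Vanishing of the Schouten bracket over `U`. -/
def SchoutenVanishes (U : Set E3) (P Q : Op) : Prop :=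
  ∀ u ξ η ζ : ℝ → E3, IsField U u → ContDiff ℝ ∞ ξ → ContDiff ℝ ∞ η → ContDiff ℝ ∞ ζ →
    HasCompactSupport ξ → HasCompactSupport η → HasCompactSupport ζ →
    schouten P Q u ξ η ζ = 0

/-- `P₀ + ε P₁` (modulo `ε²`) is a homogeneous deformation of `P₀`: `P₁` is a skew-adjoint operator
of degree two and `[P₀ + ε P₁, P₀ + ε P₁] = O(ε²)`, i.e. `[P₀, P₀] = 0` and `[P₀, P₁] = 0`. -/
def IsDeformation (U : Set E3) (P₁ : Op) : Prop :=
  IsHomogeneousTwo U P₁ ∧ IsSkew U P₁ ∧ SchoutenVanishes U P0 P0 ∧ SchoutenVanishes U P0 P₁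

/-- Coefficients `X u i k = X^i_k(u)` of a vector field of degree one, `X^i = X^i_k(u) u^k_x`. -/
abbrev VField : Type := E3 → Fin 3 → Fin 3 → ℝ

/-- The value `X^i = X^i_k(u) u^k_x` along the field `u`. -/
noncomputable def VField.eval (X : VField) (u : ℝ → E3) : ℝ → E3 :=
  fun x i => ∑ k, X (u x) i k * deriv u x k

/-- The partial derivative `∂_j X^i_k` at the point `p`. -/
noncomputable def VField.partialD (X : VField) (j i k : Fin 3) (p : E3) : ℝ :=
  fderiv ℝ (fun q => X q i k) p (Pi.single j 1)

/-- The linearization `(X_* η)^i = ∂_j X^i_k u^k_x η^j + X^i_j η^j_x`. -/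
noncomputable def VField.lin (X : VField) (u η : ℝ → E3) : ℝ → E3 :=
  fun x i => ∑ j, ((∑ k, X.partialD j i k (u x) * deriv u x k) * η x j
    + X (u x) i j * deriv η x j)

/-- The formal adjoint of the linearization:
`(X_*† ξ)_j = ∂_j X^i_k u^k_x ξ_i - (X^i_j ξ_i)_x`. -/
noncomputable def VField.linAdj (X : VField) (u ξ : ℝ → E3) : ℝ → E3 :=
  fun x j => (∑ i, (∑ k, X.partialD j i k (u x) * deriv u x k) * ξ x i)
    - deriv (fun y => ∑ i, X (u y) i j * ξ y i) x

/-- The Lie derivative of an operator, `Lie_X P = P'[X] - X_* P - P X_*†`. -/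
noncomputable def lie (X : VField) (P : Op) : Op := fun u ξ =>
  variation P u (X.eval u) ξ - X.lin u (P u ξ) - P u (X.linAdj u ξ)

/-- Jacobian matrix of a map of the coordinate space. -/
noncomputable def jacobian (φ : E3 → E3) (p : E3) : Matrix (Fin 3) (Fin 3) ℝ :=
  Matrix.of fun i j => fderiv ℝ φ p (Pi.single j 1) i

/-- `Q` is the transform of `P` under the change of coordinates `v = Φ(u)`:
`Q(v) = J P(u) Jᵗ`, with `J = ∂v/∂u`. -/
def IsTransform (Φ : OpenPartialHomeomorph E3 E3) (P Q : Op) : Prop :=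
  ∀ u ξ : ℝ → E3, IsField Φ.source u → ContDiff ℝ ∞ ξ →
    Q (fun x => Φ (u x)) ξ =
      fun x => jacobian Φ (u x) *ᵥ P u (fun y => (jacobian Φ (u y))ᵀ *ᵥ ξ y) x

/-- Infinitesimal Miura equivalence over `U`: `Q₁ = P₁ + Lie_X P₀` with `X` of degree one. -/
def InfMiuraEquiv (U : Set E3) (P₁ Q₁ : Op) : Prop :=
  ∃ X : VField, ContDiffOn ℝ ∞ X U ∧ OpEqOn U (P₁ + lie X P0) Q₁

/-- A Miura transformation with leading term the local change of coordinates `Φ` carries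
`P₀ + ε P₁` (over `Φ.source`) to `P₀ + ε Q₁` (over `Φ.target`) modulo `ε²`. Modulo `ε²`, the Miura
group is the semidirect product of local changes of coordinates and of the transformations
`P₁ ↦ P₁ + Lie_X P₀`, with `X` of degree one. -/
structure IsMiura (Φ : OpenPartialHomeomorph E3 E3) (P₁ Q₁ : Op) : Prop where
  smooth : ContDiffOn ℝ ∞ Φ Φ.source
  smooth_symm : ContDiffOn ℝ ∞ Φ.symm Φ.target
  leading : IsTransform Φ P0 P0
  first : ∃ X : VField, ContDiffOn ℝ ∞ X Φ.source ∧ IsTransform Φ (P₁ + lie X P0) Q₁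

/-- The functional parameters (functions of `u³`) of the infinitesimal normal form. -/
structure NFParams where
  b : ℝ → ℝ
  e21 : ℝ → ℝ
  e31 : ℝ → ℝ
  e32 : ℝ → ℝ
  c21 : ℝ → ℝ
  c31 : ℝ → ℝ
  c32 : ℝ → ℝ

/-- The values taken by `u³` on `U`. -/
def thirdRange (U : Set E3) : Set ℝ := (fun u : E3 => u 2) '' U

/-- All parameters are smooth functions of `u³` over `U`. -/
def NFParams.SmoothOn (a : NFParams) (U : Set E3) : Prop :=
  ∀ f ∈ [a.b, a.e21, a.e31, a.e32, a.c21, a.c31, a.c32], ContDiffOn ℝ ∞ f (thirdRange U)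

/-- All `e^{ij}` and `c^{ij}` are nowhere zero over `U`. -/
def NFParams.GenericOn (a : NFParams) (U : Set E3) : Prop :=
  ∀ f ∈ [a.e21, a.e31, a.e32, a.c21, a.c31, a.c32], ∀ t ∈ thirdRange U, f t ≠ 0

/-- `e (u³_x)² + c u³_{xx}`. -/
noncomputable def gam (e c : ℝ → ℝ) (u : ℝ → E3) (x : ℝ) : ℝ :=
  e (u x 2) * (deriv u x 2) ^ 2 + c (u x 2) * deriv (deriv u) x 2

/-- The infinitesimal normal form: the matrix `β d/dx + γ` with `β³³ = b u³_x` the only entry of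
`β`, with `γ^{ij} = -γ^{ji} = e^{ij} (u³_x)² + c^{ij} u³_{xx}` for `i > j`, `γ¹¹ = γ²² = 0` and
`γ³³ = ½ (b u³_x)_x`. -/
noncomputable def normalForm (a : NFParams) : Op := fun u ξ x =>
  ![- gam a.e21 a.c21 u x * ξ x 1 - gam a.e31 a.c31 u x * ξ x 2,
    gam a.e21 a.c21 u x * ξ x 0 - gam a.e32 a.c32 u x * ξ x 2,
    gam a.e31 a.c31 u x * ξ x 0 + gam a.e32 a.c32 u x * ξ x 1
      + a.b (u x 2) * deriv u x 2 * deriv ξ x 2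
      + (1 / 2) * deriv (fun y => a.b (u y 2) * deriv u y 2) x * ξ x 2]

/-- The parameters with `b = e²¹ = c²¹ = e³¹ = 0` and `(e³², c³¹, c³²) = (h 0, h 1, h 2)`. -/
def reduced (h : Fin 3 → ℝ → ℝ) : NFParams :=
  { b := 0, e21 := 0, e31 := 0, e32 := h 0, c21 := 0, c31 := h 1, c32 := h 2 }

/-- The three functions are smooth functions of `u³` over `U`, with `c³¹` and `c³²`
nowhere zero. -/
def Admissible (h : Fin 3 → ℝ → ℝ) (U : Set E3) : Prop :=
  (∀ i, ContDiffOn ℝ ∞ (h i) (thirdRange U)) ∧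
    ∀ t ∈ thirdRange U, h 1 t ≠ 0 ∧ h 2 t ≠ 0

end DegPoisson

/-!
The coordinate changes preserving `diag(d/dx, d/dx, 0)` act on `(u¹, u²)` by a locally constant
orthogonal matrix and a shift depending on `u³`, and on `u³` by a function `φ(u³)`. On the skew
matrix `γ` of a normal form with `b = 0` they act by `γ ↦ J γ Jᵗ`, while
`u³_{xx} ↦ φ' u³_{xx} + φ'' (u³_x)²`. An infinitesimal transformation along
`A(u³) u³_x (-u² ∂₁ + u¹ ∂₂)` adds the total derivative `(A u³_x)_x` to `γ²¹`
(`normalForm_add_lie_rotationField`).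

*Reduction* (`exists_isMiura_reduced`). For the shear `(u¹, u² + F(u³), φ(u³))` combined with such a
transformation, the coefficients change as in `isTransform_normalForm_shear`. Solving
`φ'' / φ' = e³¹ / c³¹` removes `e³¹`; the remaining conditions `c²¹ = e²¹ = 0` read
`c²¹ + F' c³¹ + A = 0` and `e²¹ + F' e³¹ + A' = 0`, which after elimination of `F'` become a linear
first-order equation for `A`.

*All triples of functions occur* (`isDeformation_normalForm_reduced`, `exists_isMiura_generic`). The
coefficients of a reduced normal form depend on `u³` alone, and the image of `P0` has no third
component, so the Schouten bracket with `P0` vanishes termwise. The shear with `φ'' = k φ'` and the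
transformation with `A = 1` make all the coefficients nonzero near a given point, for suitable `k`.

*Rigidity* (`reduced_rigidity`). For a constant covector `ξ`, the first two components of `Jᵗ ξ` are
constant along every field, so Lie derivatives of `P0` do not contribute to the third component of
the transformed operator (`miura_third_component`). With `R` the orthogonal block of `J`, comparison
of coefficients along a line parallel to the `u³`-axis gives, for a transformation from `h` to `f`
(numbered from `0`, as in Lean),
`f₁ ∘ φ = R₀₀ h₁ + R₀₁ h₂`, `f₂ ∘ φ = R₁₀ h₁ + R₁₁ h₂`, `(f₁ ∘ φ) φ'' = φ' R₀₁ h₀` and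
`(f₀ ∘ φ) φ'² + (f₂ ∘ φ) φ'' = φ' R₁₁ h₀` (`reduced_relations`). As `f₁` does not vanish, the third
relation is a second-order equation determining `φ` from its first jet at a point, and then the
other relations determine `f`.
-/

namespace DegPoisson

/-! ### Calculus of fields and of operators -/

theorem deriv_apply {u : ℝ → E3} {x : ℝ} (hu : DifferentiableAt ℝ u x) (k : Fin 3) :
    deriv u x k = deriv (fun y => u y k) x :=
  (hasDerivAt_pi.1 hu.hasDerivAt k).deriv.symm

theorem contDiff_deriv {E : Type*} [NormedAddCommGroup E] [NormedSpace ℝ E] {u : ℝ → E}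
    (hu : ContDiff ℝ ∞ u) : ContDiff ℝ ∞ (deriv u) :=
  (contDiff_infty_iff_deriv.1 hu).2

theorem contDiff_component {u : ℝ → E3} (hu : ContDiff ℝ ∞ u) (k : Fin 3) :
    ContDiff ℝ ∞ (fun x => u x k) :=
  contDiff_pi.1 hu k

theorem deriv_deriv_apply {u : ℝ → E3} (hu : ContDiff ℝ ∞ u) (x : ℝ) (k : Fin 3) :
    deriv (deriv u) x k = deriv (deriv fun y => u y k) x := by
  rw [deriv_apply ((contDiff_deriv hu).differentiable (by simp) x)]
  congr 1
  funext y
  exact deriv_apply (hu.differentiable (by simp) y) k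

theorem IsField.mono {U V : Set E3} (h : U ⊆ V) {u : ℝ → E3} (hu : IsField U u) : IsField V u :=
  ⟨hu.1, fun x => h (hu.2 x)⟩

theorem contDiff_comp_field {E : Type*} [NormedAddCommGroup E] [NormedSpace ℝ E] {U : Set E3}
    {f : E3 → E} (hf : ContDiffOn ℝ ∞ f U) {u : ℝ → E3} (hu : IsField U u) :
    ContDiff ℝ ∞ (fun x => f (u x)) :=
  contDiffOn_univ.1 (hf.comp hu.1.contDiffOn fun x _ => hu.2 x)

theorem contDiff_P0 {ξ : ℝ → E3} (hξ : ContDiff ℝ ∞ ξ) (u : ℝ → E3) :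
    ContDiff ℝ ∞ (P0 u ξ) := by
  refine contDiff_pi.2 fun i => ?_
  fin_cases i
  · exact contDiff_component (contDiff_deriv hξ) 0
  · exact contDiff_component (contDiff_deriv hξ) 1
  · exact contDiff_const

theorem variation_P0 (u Y ξ : ℝ → E3) : variation P0 u Y ξ = 0 := by
  funext x i
  simp [variation, P0]

theorem lie_P0_apply (X : VField) (u ξ : ℝ → E3) (x : ℝ) (i : Fin 3) :
    lie X P0 u ξ x i = -X.lin u (P0 u ξ) x i - P0 u (X.linAdj u ξ) x i := by
  simp [lie, variation_P0]

theorem contDiffOn_entry {U : Set E3} {X : VField} (hX : ContDiffOn ℝ ∞ X U) (i k : Fin 3) :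
    ContDiffOn ℝ ∞ (fun q => X q i k) U :=
  contDiffOn_pi.1 (contDiffOn_pi.1 hX i) k

theorem VField.contDiffOn_partialD {U : Set E3} (hU : IsOpen U) {X : VField}
    (hX : ContDiffOn ℝ ∞ X U) (j i k : Fin 3) : ContDiffOn ℝ ∞ (X.partialD j i k) U :=
  ((contDiffOn_entry hX i k).fderiv_of_isOpen hU (by simp)).clm_apply contDiffOn_const

theorem VField.contDiff_linAdj {U : Set E3} (hU : IsOpen U) {X : VField}
    (hX : ContDiffOn ℝ ∞ X U) {u ξ : ℝ → E3} (hu : IsField U u) (hξ : ContDiff ℝ ∞ ξ) :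
    ContDiff ℝ ∞ (X.linAdj u ξ) := by
  refine contDiff_pi.2 fun j => ContDiff.sub ?_ (contDiff_deriv ?_)
  · refine ContDiff.sum fun i _ =>
      ContDiff.mul (ContDiff.sum fun k _ => ?_) (contDiff_component hξ i)
    exact (contDiff_comp_field (X.contDiffOn_partialD hU hX j i k) hu).mul
      (contDiff_component (contDiff_deriv hu.1) k)
  · exact ContDiff.sum fun i _ =>
      (contDiff_comp_field (contDiffOn_entry hX i j) hu).mul (contDiff_component hξ i)

theorem lie_add {U : Set E3} (hU : IsOpen U) {X Y : VField} (hX : ContDiffOn ℝ ∞ X U)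
    (hY : ContDiffOn ℝ ∞ Y U) : OpEqOn U (lie (X + Y) P0) (lie X P0 + lie Y P0) := by
  intro u ξ hu hξ
  have hp : ∀ x j i k, VField.partialD (X + Y) j i k (u x)
      = X.partialD j i k (u x) + Y.partialD j i k (u x) := by
    intro x j i k
    have h1 := ((contDiffOn_entry hX i k).contDiffAt (hU.mem_nhds (hu.2 x))).differentiableAt
      (by simp)
    have h2 := ((contDiffOn_entry hY i k).contDiffAt (hU.mem_nhds (hu.2 x))).differentiableAt
      (by simp)
    simp only [VField.partialD, Pi.add_apply]
    rw [fderiv_fun_add h1 h2]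
    rfl
  have hadj : VField.linAdj (X + Y) u ξ = X.linAdj u ξ + Y.linAdj u ξ := by
    funext x j
    have hs : ∀ {Z : VField}, ContDiffOn ℝ ∞ Z U →
        DifferentiableAt ℝ (fun y => ∑ i, Z (u y) i j * ξ y i) x := fun hZ =>
      (ContDiff.sum fun i _ => (contDiff_comp_field (contDiffOn_entry hZ i j) hu).mul
        (contDiff_component hξ i) : ContDiff ℝ ∞ _).differentiable (by simp) x
    simp only [VField.linAdj, hp, Pi.add_apply, add_mul, Finset.sum_add_distrib]
    rw [deriv_fun_add (hs hX) (hs hY)]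
    ring
  have hd : ∀ {Z : VField}, ContDiffOn ℝ ∞ Z U → ∀ x, DifferentiableAt ℝ (Z.linAdj u ξ) x :=
    fun hZ x => (VField.contDiff_linAdj hU hZ hu hξ).differentiable (by simp) x
  have hP : ∀ x, deriv (X.linAdj u ξ + Y.linAdj u ξ) x
      = deriv (X.linAdj u ξ) x + deriv (Y.linAdj u ξ) x := fun x =>
    deriv_add (hd hX x) (hd hY x)
  funext x i
  simp only [Pi.add_apply, lie_P0_apply, hadj]
  have h1 : VField.lin (X + Y) u (P0 u ξ) x i
      = X.lin u (P0 u ξ) x i + Y.lin u (P0 u ξ) x i := by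
    simp only [VField.lin, hp, Pi.add_apply, add_mul, Finset.sum_add_distrib]
    ring
  rw [h1]
  fin_cases i <;> simp [P0, hP] <;> ring

/-! ### One-variable tools -/

theorem exists_contDiff_antiderivative {f : ℝ → ℝ} (hf : ContDiff ℝ ∞ f) :
    ∃ F : ℝ → ℝ, ContDiff ℝ ∞ F ∧ deriv F = f := by
  have h : ∀ t, HasDerivAt (fun t => ∫ s in (0 : ℝ)..t, f s) (f t) t := fun t =>
    intervalIntegral.integral_hasDerivAt_right (hf.continuous.intervalIntegrable _ _)
      (hf.continuous.stronglyMeasurableAtFilter _ _) hf.continuous.continuousAt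
  have hd : deriv (fun t => ∫ s in (0 : ℝ)..t, f s) = f := funext fun t => (h t).deriv
  exact ⟨_, contDiff_infty_iff_deriv.2 ⟨fun t => (h t).differentiableAt, by rwa [hd]⟩, hd⟩

/-- A germ of a smooth function is the germ of a globally smooth function. -/
theorem exists_contDiff_eventuallyEq {f : ℝ → ℝ} {T : Set ℝ} {t : ℝ} (hT : T ∈ 𝓝 t)
    (hf : ContDiffOn ℝ ∞ f T) : ∃ g : ℝ → ℝ, ContDiff ℝ ∞ g ∧ g =ᶠ[𝓝 t] f := by
  obtain ⟨r, hr, hrT⟩ := Metric.mem_nhds_iff.1 hT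
  let χ : ContDiffBump t := ⟨r / 3, r / 2, by positivity, by linarith⟩
  refine ⟨fun s => χ s * f s, contDiff_iff_contDiffAt.2 fun s => ?_, ?_⟩
  · by_cases hs : s ∈ Metric.ball t r
    · exact χ.contDiff.contDiffAt.mul
        ((hf.mono hrT).contDiffAt (Metric.isOpen_ball.mem_nhds hs))
    · have : s ∉ tsupport χ := by
        rw [χ.tsupport_eq]
        intro h
        exact hs (Metric.closedBall_subset_ball (by change r / 2 < r; linarith) h)
      have h0 : (fun s => χ s * f s) =ᶠ[𝓝 s] fun _ => 0 := by
        filter_upwards [notMem_tsupport_iff_eventuallyEq.1 this] with y hy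
        simp [hy]
      exact contDiffAt_const.congr_of_eventuallyEq h0
  · filter_upwards [χ.eventuallyEq_one] with s hs
    simp [hs]

/-! ### Shears preserving the undeformed structure -/

/-- The map `(u¹, u², u³) ↦ (u¹, u² + F(u³), φ(u³))`. -/
def shearMap (φ F : ℝ → ℝ) : E3 → E3 := fun u => ![u 0, u 1 + F (u 2), φ (u 2)]

theorem contDiff_shearMap {φ F : ℝ → ℝ} (hφ : ContDiff ℝ ∞ φ) (hF : ContDiff ℝ ∞ F) :
    ContDiff ℝ ∞ (shearMap φ F) := by
  have h : ∀ i : Fin 3, ContDiff ℝ ∞ fun u : E3 => u i := fun i => contDiff_apply ℝ ℝ i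
  refine contDiff_pi.2 fun i => ?_
  fin_cases i
  · exact h 0
  · exact (h 1).add (hF.comp (h 2))
  · exact hφ.comp (h 2)

theorem jacobian_shearMap {φ F : ℝ → ℝ} {p : E3} (hφ : DifferentiableAt ℝ φ (p 2))
    (hF : DifferentiableAt ℝ F (p 2)) :
    jacobian (shearMap φ F) p = !![1, 0, 0; 0, 1, deriv F (p 2); 0, 0, deriv φ (p 2)] := by
  let π : Fin 3 → E3 →L[ℝ] ℝ := ContinuousLinearMap.proj
  have hπ : ∀ i, HasFDerivAt (fun u : E3 => u i) (π i) p := fun i => (π i).hasFDerivAt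
  have h : HasFDerivAt (shearMap φ F)
      (ContinuousLinearMap.pi ![π 0, π 1 + deriv F (p 2) • π 2, deriv φ (p 2) • π 2]) p := by
    refine hasFDerivAt_pi.2 fun i => ?_
    fin_cases i
    · exact hπ 0
    · exact (hπ 1).add (hF.hasDerivAt.comp_hasFDerivAt p (hπ 2))
    · exact hφ.hasDerivAt.comp_hasFDerivAt p (hπ 2)
  ext i j
  rw [jacobian, Matrix.of_apply, h.fderiv]
  fin_cases i <;> fin_cases j <;> simp [π]

/-- Shears exist as local diffeomorphisms with arbitrarily small source; `τ` is the corresponding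
local inverse of `φ`. -/
theorem exists_shear {U : Set E3} (hU : IsOpen U) {p : E3} (hp : p ∈ U) {S : Set ℝ}
    (hS : S ∈ 𝓝 (p 2)) {φ F : ℝ → ℝ} (hφ : ContDiff ℝ ∞ φ) (hF : ContDiff ℝ ∞ F)
    (hp' : deriv φ (p 2) ≠ 0) :
    ∃ (Φ : OpenPartialHomeomorph E3 E3) (τ : ℝ → ℝ), ⇑Φ = shearMap φ F ∧ p ∈ Φ.source ∧
      Φ.source ⊆ U ∧ (∀ t ∈ thirdRange Φ.source, t ∈ S ∧ deriv φ t ≠ 0 ∧ τ (φ t) = t) ∧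
      thirdRange Φ.target = φ '' thirdRange Φ.source ∧
      ContDiffOn ℝ ∞ Φ.symm Φ.target ∧ ContDiffOn ℝ ∞ τ (thirdRange Φ.target) := by
  have hst : HasStrictDerivAt φ (deriv φ (p 2)) (p 2) :=
    hφ.contDiffAt.hasStrictDerivAt (by simp)
  let ψ : OpenPartialHomeomorph ℝ ℝ :=
    (hst.hasStrictFDerivAt_equiv hp').toOpenPartialHomeomorph φ
  have hψ : ⇑ψ = φ := HasStrictFDerivAt.toOpenPartialHomeomorph_coe _
  have hpψ : p 2 ∈ ψ.source := HasStrictFDerivAt.mem_toOpenPartialHomeomorph_source _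
  let Φ₀ : OpenPartialHomeomorph E3 E3 :=
    { toFun := shearMap ψ F
      invFun := fun v => ![v 0, v 1 - F (ψ.symm (v 2)), ψ.symm (v 2)]
      source := {u | u 2 ∈ ψ.source}
      target := {v | v 2 ∈ ψ.target}
      map_source' := fun u hu => ψ.map_source hu
      map_target' := fun v hv => ψ.map_target hv
      left_inv' := fun u hu => by
        ext i
        fin_cases i <;> simp [shearMap, ψ.left_inv hu]
      right_inv' := fun v hv => by
        ext i
        fin_cases i <;> simp [shearMap, ψ.right_inv hv]
      open_source := ψ.open_source.preimage (continuous_apply 2)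
      open_target := ψ.open_target.preimage (continuous_apply 2)
      continuousOn_toFun := by
        rw [hψ]
        exact (contDiff_shearMap hφ hF).continuous.continuousOn
      continuousOn_invFun := by
        have h2 : ContinuousOn (fun v : E3 => ψ.symm (v 2)) {v | v 2 ∈ ψ.target} :=
          ψ.continuousOn_symm.comp (continuous_apply 2).continuousOn fun v hv => hv
        refine continuousOn_pi.2 fun i => ?_
        fin_cases i
        · exact (continuous_apply 0).continuousOn
        · exact (continuous_apply 1).continuousOn.sub (hF.continuous.comp_continuousOn h2)
        · exact h2 }
  have hcont : Continuous (deriv φ) := (contDiff_deriv hφ).continuous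
  let W : Set E3 := U ∩ {u | u 2 ∈ interior S ∧ deriv φ (u 2) ≠ 0}
  have hW : IsOpen W := hU.inter <|
    (isOpen_interior.inter (isOpen_ne.preimage hcont)).preimage
      (continuous_apply 2 : Continuous fun u : E3 => u 2)
  have hΦ : ⇑(Φ₀.restrOpen W hW) = shearMap φ F := by
    rw [← hψ]
    rfl
  have hsrc : ∀ {u}, u ∈ (Φ₀.restrOpen W hW).source ↔ u 2 ∈ ψ.source ∧ u ∈ W := fun {u} => by
    rw [Φ₀.restrOpen_source]
    rfl
  have htgt : ∀ v ∈ (Φ₀.restrOpen W hW).target,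
      ψ.symm (v 2) ∈ thirdRange (Φ₀.restrOpen W hW).source ∧ v 2 ∈ ψ.target := fun v hv =>
    ⟨⟨_, (Φ₀.restrOpen W hW).map_target hv, rfl⟩, hv.1⟩
  have hτ : ∀ v ∈ (Φ₀.restrOpen W hW).target, ContDiffAt ℝ ∞ ψ.symm (v 2) := by
    intro v hv
    obtain ⟨⟨u, hu, hu2⟩, hv2⟩ := htgt v hv
    have hne : deriv φ (ψ.symm (v 2)) ≠ 0 := hu2 ▸ (hsrc.1 hu).2.2.2
    refine ψ.contDiffAt_symm_deriv hne hv2 ?_ ?_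
    · rw [hψ]
      exact (hφ.differentiable (by simp) _).hasDerivAt
    · rw [hψ]
      exact hφ.contDiffAt
  refine ⟨Φ₀.restrOpen W hW, ψ.symm, hΦ, ?_, ?_, ?_, ?_, ?_, ?_⟩
  · exact hsrc.2 ⟨hpψ, hp, mem_interior_iff_mem_nhds.2 hS, hp'⟩
  · exact fun u hu => (hsrc.1 hu).2.1
  · rintro _ ⟨u, hu, rfl⟩
    obtain ⟨h1, -, h2, h3⟩ := hsrc.1 hu
    refine ⟨interior_subset h2, h3, ?_⟩
    rw [← hψ]
    exact ψ.left_inv h1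
  · rw [← (Φ₀.restrOpen W hW).image_source_eq_target, hΦ]
    simp only [thirdRange, Set.image_image]
    rfl
  · intro v hv
    have h2 : ContDiffAt ℝ ∞ (fun v : E3 => ψ.symm (v 2)) v :=
      ContDiffAt.comp v (hτ v hv) (contDiff_apply ℝ ℝ 2).contDiffAt
    refine ContDiffAt.contDiffWithinAt (contDiffAt_pi.2 fun i => ?_)
    fin_cases i
    · exact (contDiff_apply ℝ ℝ 0).contDiffAt
    · exact (contDiff_apply ℝ ℝ 1).contDiffAt.sub (hF.contDiffAt.comp v h2)
    · exact h2
  · rintro _ ⟨v, hv, rfl⟩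
    exact (hτ v hv).contDiffWithinAt

theorem contDiff_jacobian_transpose_mulVec {Φ : OpenPartialHomeomorph E3 E3}
    (hΦ : ContDiffOn ℝ ∞ Φ Φ.source) {u ξ : ℝ → E3} (hu : IsField Φ.source u)
    (hξ : ContDiff ℝ ∞ ξ) : ContDiff ℝ ∞ fun x => (jacobian Φ (u x))ᵀ *ᵥ ξ x := by
  have hd := contDiff_comp_field (hΦ.fderiv_of_isOpen Φ.open_source (m := ∞) (by simp)) hu
  refine contDiff_pi.2 fun j => ?_
  simp only [Matrix.mulVec, dotProduct, Matrix.transpose_apply, jacobian, Matrix.of_apply]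
  exact ContDiff.sum fun i _ => ContDiff.mul (contDiff_pi.1 (hd.clm_apply contDiff_const) i)
    (contDiff_component hξ i)

/-- The source operator of a transformation may be replaced by an equal one. -/
theorem IsTransform.congr_source {Φ : OpenPartialHomeomorph E3 E3}
    (hΦ : ContDiffOn ℝ ∞ Φ Φ.source) {P P' Q : Op} (h : IsTransform Φ P Q)
    (hP : OpEqOn Φ.source P' P) : IsTransform Φ P' Q := by
  intro u ξ hu hξ
  rw [h u ξ hu hξ, hP u _ hu (contDiff_jacobian_transpose_mulVec hΦ hu hξ)]

theorem isTransform_P0_shear {Φ : OpenPartialHomeomorph E3 E3} {φ F : ℝ → ℝ}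
    (hΦ : ⇑Φ = shearMap φ F) (hφ : ContDiff ℝ ∞ φ) (hF : ContDiff ℝ ∞ F) :
    IsTransform Φ P0 P0 := by
  intro u ξ hu hξ
  have hη := contDiff_jacobian_transpose_mulVec
    (hΦ ▸ (contDiff_shearMap hφ hF).contDiffOn) hu hξ
  funext x
  have h0 := deriv_apply (hη.differentiable (by simp) x) 0
  have h1 := deriv_apply (hη.differentiable (by simp) x) 1
  have h0' := deriv_apply (hξ.differentiable (by simp) x) 0
  have h1' := deriv_apply (hξ.differentiable (by simp) x) 1
  have hJ : ∀ q, jacobian Φ q = !![1, 0, 0; 0, 1, deriv F (q 2); 0, 0, deriv φ (q 2)] :=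
    fun q => by
      rw [hΦ]
      exact jacobian_shearMap (hφ.differentiable (by simp) _) (hF.differentiable (by simp) _)
  simp only [hJ] at h0 h1
  simp only [P0, hJ, h0, h1, h0', h1']
  ext i
  fin_cases i <;> simp [Matrix.mulVec, dotProduct, Fin.sum_univ_three]

/-! ### The normal form under shears and infinitesimal transformations -/

theorem normalForm_of_b_eq_zero {a : NFParams} {u : ℝ → E3} (hb : ∀ x, a.b (u x 2) = 0)
    (ξ : ℝ → E3) (x : ℝ) :
    normalForm a u ξ x =
      ![-gam a.e21 a.c21 u x * ξ x 1 - gam a.e31 a.c31 u x * ξ x 2,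
        gam a.e21 a.c21 u x * ξ x 0 - gam a.e32 a.c32 u x * ξ x 2,
        gam a.e31 a.c31 u x * ξ x 0 + gam a.e32 a.c32 u x * ξ x 1] := by
  simp [normalForm, hb]

theorem gam_eq {u : ℝ → E3} (hu : ContDiff ℝ ∞ u) (e c : ℝ → ℝ) (x : ℝ) :
    gam e c u x = e (u x 2) * deriv (fun y => u y 2) x ^ 2
      + c (u x 2) * deriv (deriv fun y => u y 2) x := by
  rw [gam, deriv_deriv_apply hu, deriv_apply (hu.differentiable (by simp) x)]

/-- How `e (u³_x)² + c u³_{xx}` changes when `u³` is replaced by a function of it. -/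
theorem gam_comp {u v : ℝ → E3} {φ : ℝ → ℝ} (hu : ContDiff ℝ ∞ u) (hv : ContDiff ℝ ∞ v)
    (hφ : ∀ x, ContDiffAt ℝ ∞ φ (u x 2)) (huv : ∀ x, v x 2 = φ (u x 2)) (e c : ℝ → ℝ) (x : ℝ) :
    gam e c v x =
      (e (φ (u x 2)) * deriv φ (u x 2) ^ 2 + c (φ (u x 2)) * deriv (deriv φ) (u x 2))
          * deriv (fun y => u y 2) x ^ 2
        + c (φ (u x 2)) * deriv φ (u x 2) * deriv (deriv fun y => u y 2) x := by
  have ht := contDiff_component hu 2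
  have hd : ∀ x, HasDerivAt (fun y => u y 2) (deriv (fun y => u y 2) x) x := fun x =>
    (ht.differentiable (by simp) x).hasDerivAt
  have h1 : (deriv fun y => φ (u y 2)) = fun y => deriv φ (u y 2) * deriv (fun y => u y 2) y :=
    funext fun y =>
      (((hφ y).differentiableAt (by simp)).hasDerivAt.comp y (hd y)).deriv
  have h2 : HasDerivAt (deriv φ) (deriv (deriv φ) (u x 2)) (u x 2) := by
    have : ContDiffAt ℝ ∞ (deriv φ) (u x 2) :=
      ((hφ x).fderiv_right (m := ∞) (by simp)).clm_apply contDiffAt_const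
    exact (this.differentiableAt (by simp)).hasDerivAt
  have h3 : HasDerivAt (deriv fun y => u y 2) (deriv (deriv fun y => u y 2) x) x :=
    ((contDiff_deriv ht).differentiable (by simp) x).hasDerivAt
  rw [gam_eq hv]
  simp only [huv]
  have h4 : HasDerivAt (fun y => deriv φ (u y 2))
      (deriv (deriv φ) (u x 2) * deriv (fun y => u y 2) x) x :=
    HasDerivAt.comp (h₂ := deriv φ) x h2 (hd x)
  rw [h1, (h4.fun_mul h3).deriv]
  ring

theorem isTransform_normalForm_shear {Φ : OpenPartialHomeomorph E3 E3} {φ F : ℝ → ℝ}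
    (hΦ : ⇑Φ = shearMap φ F) (hφ : ContDiff ℝ ∞ φ) (hF : ContDiff ℝ ∞ F) {a a' : NFParams}
    (hb : ∀ t ∈ thirdRange Φ.source, a.b t = 0)
    (hb' : ∀ t ∈ thirdRange Φ.source, a'.b (φ t) = 0)
    (hc31 : ∀ t ∈ thirdRange Φ.source, a'.c31 (φ t) = a.c31 t)
    (hc32 : ∀ t ∈ thirdRange Φ.source, a'.c32 (φ t) = a.c32 t)
    (hc21 : ∀ t ∈ thirdRange Φ.source,
      a'.c21 (φ t) * deriv φ t = a.c21 t + deriv F t * a.c31 t)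
    (he31 : ∀ t ∈ thirdRange Φ.source,
      a'.e31 (φ t) * deriv φ t ^ 2 + a.c31 t * deriv (deriv φ) t = a.e31 t * deriv φ t)
    (he32 : ∀ t ∈ thirdRange Φ.source,
      a'.e32 (φ t) * deriv φ t ^ 2 + a.c32 t * deriv (deriv φ) t = a.e32 t * deriv φ t)
    (he21 : ∀ t ∈ thirdRange Φ.source,
      a'.e21 (φ t) * deriv φ t ^ 2 + a'.c21 (φ t) * deriv (deriv φ) t
        = a.e21 t + deriv F t * a.e31 t) :
    IsTransform Φ (normalForm a) (normalForm a') := by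
  intro u ξ hu hξ
  have hmem : ∀ x, u x 2 ∈ thirdRange Φ.source := fun x => ⟨u x, hu.2 x, rfl⟩
  have hv : ContDiff ℝ ∞ fun x => Φ (u x) := by
    rw [hΦ]
    exact (contDiff_shearMap hφ hF).comp hu.1
  have hv2 : ∀ x, Φ (u x) 2 = φ (u x 2) := fun x => by
    rw [hΦ]
    rfl
  funext x
  have hJ : jacobian Φ (u x) = !![1, 0, 0; 0, 1, deriv F (u x 2); 0, 0, deriv φ (u x 2)] := by
    rw [hΦ]
    exact jacobian_shearMap (hφ.differentiable (by simp) _) (hF.differentiable (by simp) _)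
  rw [normalForm_of_b_eq_zero (fun x => by rw [hv2]; exact hb' _ (hmem x)),
    normalForm_of_b_eq_zero (fun x => hb _ (hmem x))]
  have hg := gam_comp hu.1 hv (fun x => hφ.contDiffAt) hv2
  simp only [hg, he31 _ (hmem x), he32 _ (hmem x), he21 _ (hmem x), hc21 _ (hmem x),
    hc31 _ (hmem x), hc32 _ (hmem x), gam_eq hu.1, hJ]
  ext i
  fin_cases i <;> simp [Matrix.mulVec, dotProduct, Fin.sum_univ_three] <;> ring

/-- The vector field `X = A(u³) u³_x (-u² ∂₁ + u¹ ∂₂)`. -/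
def rotationField (A : ℝ → ℝ) : VField := fun u i k =>
  if k = 2 then ![-(A (u 2) * u 1), A (u 2) * u 0, 0] i else 0

theorem contDiff_rotationField {A : ℝ → ℝ} (hA : ContDiff ℝ ∞ A) :
    ContDiff ℝ ∞ (rotationField A) := by
  have h : ∀ i : Fin 3, ContDiff ℝ ∞ fun u : E3 => u i := fun i => contDiff_apply ℝ ℝ i
  refine contDiff_pi.2 fun i => contDiff_pi.2 fun k => ?_
  by_cases hk : k = 2
  · fin_cases i
    · simpa [rotationField, hk] using ((hA.comp (h 2)).mul (h 1)).neg
    · simpa [rotationField, hk] using (hA.comp (h 2)).mul (h 0)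
    · simpa [rotationField, hk] using contDiff_const
  · simpa [rotationField, hk] using contDiff_const

/-- The infinitesimal transformation along `rotationField A` shifts `γ²¹` by the total derivative
`(A(u³) u³_x)_x` and changes nothing else. -/
theorem normalForm_add_lie_rotationField {A : ℝ → ℝ} (hA : ContDiff ℝ ∞ A) (U : Set E3)
    (a : NFParams) :
    OpEqOn U (normalForm a + lie (rotationField A) P0)
      (normalForm { a with e21 := a.e21 + deriv A, c21 := a.c21 + A }) := by
  intro u ξ hu hξ
  have hAd : ∀ t, DifferentiableAt ℝ A t := fun t => hA.differentiable (by simp) t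
  have hπ : ∀ (i : Fin 3) (p : E3), DifferentiableAt ℝ (fun u : E3 => u i) p := fun i p =>
    (contDiff_apply ℝ ℝ i : ContDiff ℝ ∞ _).differentiable (by simp) p
  have hfπ : ∀ (i j : Fin 3) (p : E3),
      fderiv ℝ (fun u : E3 => u i) p (Pi.single j 1) = if i = j then 1 else 0 := by
    intro i j p
    have : HasFDerivAt (fun u : E3 => u i) (ContinuousLinearMap.proj i : E3 →L[ℝ] ℝ) p :=
      (ContinuousLinearMap.proj i : E3 →L[ℝ] ℝ).hasFDerivAt
    rw [this.fderiv]
    simp [Pi.single_apply]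
  have hA2 : ∀ p : E3, DifferentiableAt ℝ (fun u : E3 => A (u 2)) p := fun p =>
    (hAd _).comp p (hπ 2 p)
  have hfA : ∀ (j : Fin 3) (p : E3), j ≠ 2 →
      fderiv ℝ (fun u : E3 => A (u 2)) p (Pi.single j 1) = 0 := by
    intro j p hj
    have := (hAd (p 2)).hasDerivAt.comp_hasFDerivAt p (hπ 2 p).hasFDerivAt
    have h2 : HasFDerivAt (fun u : E3 => A (u 2)) _ p := this
    rw [h2.fderiv]
    simp [hfπ, hj.symm]
  have hp : ∀ (j i : Fin 3) (p : E3), j ≠ 2 → (rotationField A).partialD j i 2 p =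
      if i = 0 ∧ j = 1 then -A (p 2) else if i = 1 ∧ j = 0 then A (p 2) else 0 := by
    intro j i p hj
    have h1 := fderiv_fun_mul (hA2 p) (hπ 1 p)
    have h0 := fderiv_fun_mul (hA2 p) (hπ 0 p)
    fin_cases i <;> fin_cases j <;>
      simp_all [VField.partialD, rotationField]
  have hp' : ∀ (j i k : Fin 3) (p : E3), k ≠ 2 → (rotationField A).partialD j i k p = 0 := by
    intro j i k p hk
    simp [VField.partialD, rotationField, hk]
  have hr : ∀ p i, rotationField A p i 0 = 0 ∧ rotationField A p i 1 = 0 := fun p i => by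
    simp [rotationField]
  have ht := contDiff_component hu.1 2
  have hB : ∀ x, HasDerivAt (fun y => A (u y 2) * deriv u y 2) (gam (deriv A) A u x) x := by
    intro x
    have h1 := (hAd (u x 2)).hasDerivAt.comp x (ht.differentiable (by simp) x).hasDerivAt
    have h2 := hasDerivAt_pi.1
      ((contDiff_deriv hu.1).differentiable (by simp) x).hasDerivAt 2
    refine (h1.mul h2).congr_deriv ?_
    rw [gam, ← deriv_apply (hu.1.differentiable (by simp) x)]
    simp only [Function.comp]
    ring
  have hξd : ∀ x j, HasDerivAt (fun y => ξ y j) (deriv ξ x j) x := fun x j =>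
    hasDerivAt_pi.1 (hξ.differentiable (by simp) x).hasDerivAt j
  have hP0 : ∀ x, deriv (P0 u ξ) x 2 = 0 := by
    intro x
    rw [deriv_apply ((contDiff_P0 hξ u).differentiable (by simp) x)]
    simp [P0]
  have hadj := (VField.contDiff_linAdj isOpen_univ (contDiff_rotationField hA).contDiffOn
    (hu.mono (Set.subset_univ U)) hξ).differentiable (by simp)
  -- The adjoint linearization is algebraic in `ξ`, because `X` has no `u¹_x`, `u²_x` terms.
  have hadj0 : ∀ y, (rotationField A).linAdj u ξ y 0 = A (u y 2) * deriv u y 2 * ξ y 1 := by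
    intro y
    simp [VField.linAdj, Fin.sum_univ_three, hp, hp', hr]
  have hadj1 : ∀ y, (rotationField A).linAdj u ξ y 1 = -(A (u y 2) * deriv u y 2 * ξ y 0) := by
    intro y
    simp [VField.linAdj, Fin.sum_univ_three, hp, hp', hr]
  funext x i
  have d0 := deriv_apply (hadj x) 0
  have d1 := deriv_apply (hadj x) 1
  simp only [hadj0, ((hB x).fun_mul (hξd x 1)).deriv] at d0
  simp only [hadj1, ((hB x).fun_mul (hξd x 0)).fun_neg.deriv] at d1
  simp only [Pi.add_apply, lie_P0_apply]
  have hP0' : deriv (fun x => ![deriv ξ x 0, deriv ξ x 1, 0]) x 2 = 0 := hP0 x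
  fin_cases i
  · simp [P0, VField.lin, Fin.sum_univ_three, hp, hp', hr, hP0, d0, normalForm, gam]
    ring
  · simp [P0, VField.lin, Fin.sum_univ_three, hp, hp', hr, hP0, d1, normalForm, gam]
    ring
  · simp [P0, VField.lin, Fin.sum_univ_three, hp, hp', hr, hP0, normalForm]

/-! ### Reduction to three functions -/

theorem thirdRange_mem_nhds {U : Set E3} (hU : IsOpen U) {p : E3} (hp : p ∈ U) :
    thirdRange U ∈ 𝓝 (p 2) :=
  (isOpenMap_eval 2).image_mem_nhds (hU.mem_nhds hp)

/-- A Miura transformation assembled from an infinitesimal one to the normal form `a`, a rotation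
field and a shear. -/
theorem isMiura_of_shear {U : Set E3} (hU : IsOpen U) {P₁ : Op} {a a' : NFParams} {X : VField}
    (hX : ContDiffOn ℝ ∞ X U) (hP : OpEqOn U (P₁ + lie X P0) (normalForm a)) {A : ℝ → ℝ}
    (hA : ContDiff ℝ ∞ A) {Φ : OpenPartialHomeomorph E3 E3} {φ F : ℝ → ℝ}
    (hΦ : ⇑Φ = shearMap φ F) (hφ : ContDiff ℝ ∞ φ) (hF : ContDiff ℝ ∞ F) (hΦU : Φ.source ⊆ U)
    (hsymm : ContDiffOn ℝ ∞ Φ.symm Φ.target)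
    (h : IsTransform Φ (normalForm { a with e21 := a.e21 + deriv A, c21 := a.c21 + A })
      (normalForm a')) :
    IsMiura Φ P₁ (normalForm a') := by
  have hs : ContDiffOn ℝ ∞ Φ Φ.source := by
    rw [hΦ]
    exact (contDiff_shearMap hφ hF).contDiffOn
  have hY := contDiff_rotationField hA
  refine ⟨hs, hsymm, isTransform_P0_shear hΦ hφ hF, X + rotationField A,
    (hX.mono hΦU).add hY.contDiffOn, h.congr_source hs fun u ξ hu hξ => ?_⟩
  have hu' := hu.mono hΦU
  rw [← normalForm_add_lie_rotationField hA U a u ξ hu' hξ]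
  have h1 : (P₁ + lie (X + rotationField A) P0) u ξ
      = P₁ u ξ + lie (X + rotationField A) P0 u ξ := rfl
  have h2 : (normalForm a + lie (rotationField A) P0) u ξ
      = normalForm a u ξ + lie (rotationField A) P0 u ξ := rfl
  rw [h1, h2, lie_add hU hX hY.contDiffOn u ξ hu' hξ, ← hP u ξ hu' hξ]
  simp only [Pi.add_apply, add_assoc]

theorem exists_isMiura_reduced {U : Set E3} (hU : IsOpen U) {P₁ : Op} {a : NFParams}
    (ha : a.SmoothOn U) (hb : ∀ t ∈ thirdRange U, a.b t = 0)
    (hc31 : ∀ t ∈ thirdRange U, a.c31 t ≠ 0) (hc32 : ∀ t ∈ thirdRange U, a.c32 t ≠ 0)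
    (hP : InfMiuraEquiv U P₁ (normalForm a)) {p : E3} (hp : p ∈ U) :
    ∃ (Φ : OpenPartialHomeomorph E3 E3) (h : Fin 3 → ℝ → ℝ),
      p ∈ Φ.source ∧ Φ.source ⊆ U ∧ Admissible h Φ.target ∧
        IsMiura Φ P₁ (normalForm (reduced h)) := by
  obtain ⟨X, hX, hPX⟩ := hP
  have hT := thirdRange_mem_nhds hU hp
  simp only [NFParams.SmoothOn, List.mem_cons, List.not_mem_nil, or_false, forall_eq_or_imp,
    forall_eq] at ha
  obtain ⟨-, se21, se31, se32, sc21, sc31, sc32⟩ := ha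
  obtain ⟨q, hq, hqe⟩ := exists_contDiff_eventuallyEq hT (se31.div sc31 hc31)
  obtain ⟨r, hr, hre⟩ := exists_contDiff_eventuallyEq hT (sc31.inv hc31)
  obtain ⟨c, hc, hce⟩ := exists_contDiff_eventuallyEq hT sc21
  obtain ⟨e, he, hee⟩ := exists_contDiff_eventuallyEq hT se21
  -- The leading term `φ` is chosen with `φ'' / φ' = e³¹ / c³¹`, which removes `e³¹`.
  obtain ⟨Q, hQ, hQ'⟩ := exists_contDiff_antiderivative hq
  obtain ⟨φ, hφ, hφ'⟩ := exists_contDiff_antiderivative hQ.exp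
  -- `A` solves `A' = q (A + c²¹) - e²¹`; then `F' = -(c²¹ + A) / c³¹` removes both `c²¹` and `e²¹`.
  obtain ⟨B, hB, hB'⟩ := exists_contDiff_antiderivative (hQ.neg.exp.mul ((hq.mul hc).sub he))
  have hA : ContDiff ℝ ∞ fun t => Real.exp (Q t) * B t := hQ.exp.mul hB
  obtain ⟨F, hF, hF'⟩ := exists_contDiff_antiderivative ((hc.add hA).neg.mul hr)
  have hexp : ∀ t, HasDerivAt (fun t => Real.exp (Q t)) (Real.exp (Q t) * q t) t := fun t => by
    have := (hQ.differentiable (by simp) t).hasDerivAt.exp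
    rwa [hQ'] at this
  have hφ'' : ∀ t, deriv (deriv φ) t = Real.exp (Q t) * q t := fun t => by
    rw [hφ']
    exact (hexp t).deriv
  have hA' : ∀ t, deriv (fun t => Real.exp (Q t) * B t) t
      = q t * (Real.exp (Q t) * B t + c t) - e t := fun t => by
    have hBt := (hB.differentiable (by simp) t).hasDerivAt
    simp only [hB', Real.exp_neg] at hBt
    rw [((hexp t).fun_mul hBt).deriv]
    field_simp
    ring
  obtain ⟨Φ, τ, hΦ, hpΦ, hΦU, hsrc, htgt, hsymm, hτ⟩ := exists_shear hU hp
    (Filter.inter_mem hT (hqe.and (hre.and (hce.and hee)))) hφ hF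
    (by rw [hφ']; exact (Real.exp_pos _).ne')
  let h : Fin 3 → ℝ → ℝ := ![fun s => (a.e32 (τ s) - a.c32 (τ s) * q (τ s)) * Real.exp (-Q (τ s)),
    fun s => a.c31 (τ s), fun s => a.c32 (τ s)]
  have hmaps : Set.MapsTo τ (thirdRange Φ.target) (thirdRange U) := by
    rw [htgt]
    rintro _ ⟨t, ht, rfl⟩
    rw [(hsrc t ht).2.2]
    exact (hsrc t ht).1.1
  refine ⟨Φ, h, hpΦ, hΦU, ⟨fun i => ?_, fun s hs => ⟨hc31 _ (hmaps hs), hc32 _ (hmaps hs)⟩⟩,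
    isMiura_of_shear hU hX hPX hA hΦ hφ hF hΦU hsymm ?_⟩
  · fin_cases i
    · exact ((se32.comp hτ hmaps).sub ((sc32.comp hτ hmaps).mul (hq.comp_contDiffOn hτ))).mul
        (hQ.neg.exp.comp_contDiffOn hτ)
    · exact sc31.comp hτ hmaps
    · exact sc32.comp hτ hmaps
  have key : ∀ t ∈ thirdRange Φ.source, t ∈ thirdRange U ∧ τ (φ t) = t ∧
      q t = a.e31 t / a.c31 t ∧ r t = (a.c31 t)⁻¹ ∧ c t = a.c21 t ∧ e t = a.e21 t := by
    intro t ht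
    obtain ⟨⟨h1, h2, h3, h4, h5⟩, -, h6⟩ := hsrc t ht
    exact ⟨h1, h6, h2, h3, h4, h5⟩
  refine isTransform_normalForm_shear hΦ hφ hF (fun t ht => hb t (key t ht).1)
    (fun _ _ => rfl) ?_ ?_ ?_ ?_ ?_ ?_ <;> intro t ht <;>
    obtain ⟨htU, hτt, hqt, hrt, hct, het⟩ := key t ht <;> have hne := hc31 t htU
  · simp [reduced, h, hτt]
  · simp [reduced, h, hτt]
  · simp [reduced, hF', hct, hrt, hne]
  · rw [hφ'']
    simp only [reduced, hφ', hqt, Pi.zero_apply]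
    field_simp
    ring
  · rw [hφ'']
    simp only [reduced, h, hφ', Matrix.cons_val_zero, hτt, Real.exp_neg]
    field_simp
    ring
  · simp only [reduced, hF', hA', hqt, hrt, hct, het, Pi.zero_apply, Pi.add_apply]
    field_simp
    ring

/-! ### The reduced normal forms are deformations -/

theorem variation_normalForm_reduced (h : Fin 3 → ℝ → ℝ) {u Y : ℝ → E3} (hu : ContDiff ℝ ∞ u)
    (hY : ContDiff ℝ ∞ Y) (hY2 : ∀ x, Y x 2 = 0) (ξ : ℝ → E3) :
    variation (normalForm (reduced h)) u Y ξ = 0 := by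
  have hs : ∀ s : ℝ, normalForm (reduced h) (u + s • Y) ξ = normalForm (reduced h) u ξ := by
    intro s
    have hsmooth : ContDiff ℝ ∞ (u + s • Y) := hu.add (contDiff_const.smul hY)
    funext x
    rw [normalForm_of_b_eq_zero fun _ => rfl, normalForm_of_b_eq_zero fun _ => rfl]
    simp [gam_eq hsmooth, gam_eq hu, hY2]
  funext x i
  simp [variation, hs]

theorem isHomogeneousTwo_normalForm_reduced {V : Set E3} {h : Fin 3 → ℝ → ℝ}
    (hh : ∀ i, ContDiffOn ℝ ∞ (h i) (thirdRange V)) :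
    IsHomogeneousTwo V (normalForm (reduced h)) := by
  have hs : ∀ i, ContDiffOn ℝ ∞ (fun q : E3 => h i (q 2)) V := fun i =>
    (hh i).comp (contDiff_apply ℝ ℝ 2).contDiffOn fun q hq => ⟨q, hq, rfl⟩
  have hz : ContDiffOn ℝ ∞ (fun _ : E3 => (0 : ℝ)) V := contDiffOn_const
  refine ⟨0, 0,
    fun q i j k => if k = 2 then
      ![![0, 0, -h 1 (q 2)], ![0, 0, -h 2 (q 2)], ![h 1 (q 2), h 2 (q 2), 0]] i j else 0,
    fun q i j r k => if r = 2 ∧ k = 2 then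
      ![![0, 0, 0], ![0, 0, -h 0 (q 2)], ![0, h 0 (q 2), 0]] i j else 0,
    contDiffOn_const, contDiffOn_const, ?_, ?_, ?_⟩
  · refine contDiffOn_pi.2 fun i => contDiffOn_pi.2 fun j => contDiffOn_pi.2 fun k => ?_
    by_cases hk : k = 2
    · simp only [hk, if_true]
      fin_cases i <;> fin_cases j <;>
        first | exact hz | exact hs 1 | exact hs 2 | exact (hs 1).neg | exact (hs 2).neg
    · simpa only [hk, if_false] using hz
  · refine contDiffOn_pi.2 fun i => contDiffOn_pi.2 fun j => contDiffOn_pi.2 fun r =>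
      contDiffOn_pi.2 fun k => ?_
    by_cases hk : r = 2 ∧ k = 2
    · simp only [hk, and_self, if_true]
      fin_cases i <;> fin_cases j <;> first | exact hz | exact hs 0 | exact (hs 0).neg
    · simpa only [hk, if_false] using hz
  · intro u ξ _ _
    funext x i
    fin_cases i <;>
      simp [normalForm, reduced, gam, Fin.sum_univ_three] <;> ring

theorem isDeformation_normalForm_reduced {V : Set E3} {h : Fin 3 → ℝ → ℝ}
    (hh : ∀ i, ContDiffOn ℝ ∞ (h i) (thirdRange V)) :
    IsDeformation V (normalForm (reduced h)) := by
  refine ⟨isHomogeneousTwo_normalForm_reduced hh, ?_, ?_, ?_⟩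
  · intro u ξ η _ _ _ _ _
    rw [← MeasureTheory.integral_neg]
    congr 1
    funext x
    rw [normalForm_of_b_eq_zero fun _ => rfl, normalForm_of_b_eq_zero fun _ => rfl]
    simp only [dotProduct, Fin.sum_univ_three, Matrix.cons_val]
    ring
  · intro u ξ η ζ _ _ _ _ _ _ _
    simp [schouten, schoutenTerm, variation_P0]
  · intro u ξ η ζ hu hξ hη hζ _ _ _
    have hv : ∀ {α β : ℝ → E3}, ContDiff ℝ ∞ α →
        variation (normalForm (reduced h)) u (P0 u α) β = 0 := fun hα =>
      variation_normalForm_reduced h hu.1 (contDiff_P0 hα u) (fun x => by simp [P0]) _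
    simp [schouten, schoutenTerm, variation_P0, hv hξ, hv hη, hv hζ]

/-! ### Reduced normal forms come from generic ones -/

theorem exists_isMiura_generic {V : Set E3} (hV : IsOpen V) {h : Fin 3 → ℝ → ℝ}
    (hh : Admissible h V) {p : E3} (hp : p ∈ V) :
    ∃ (Φ : OpenPartialHomeomorph E3 E3) (a : NFParams),
      p ∈ Φ.source ∧ Φ.source ⊆ V ∧ a.SmoothOn Φ.target ∧
      (∀ t ∈ thirdRange Φ.target, a.b t = 0) ∧ a.GenericOn Φ.target ∧
      IsMiura Φ (normalForm (reduced h)) (normalForm a) := by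
  obtain ⟨hs, hne⟩ := hh
  have hT := thirdRange_mem_nhds hV hp
  have hpT : p 2 ∈ thirdRange V := ⟨p, hp, rfl⟩
  -- With `φ'' = k φ'` all coefficients become nonzero as soon as `k ≠ 0` and `k c³² ≠ e³²`.
  obtain ⟨k, hk, hk2⟩ : ∃ k : ℝ, k ≠ 0 ∧ h 0 (p 2) - k * h 2 (p 2) ≠ 0 := by
    have h2 := (hne _ hpT).2
    by_cases h1 : h 0 (p 2) - 1 * h 2 (p 2) = 0
    · refine ⟨2, two_ne_zero, fun h3 => h2 ?_⟩
      linarith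
    · exact ⟨1, one_ne_zero, h1⟩
  have hkc : ContinuousAt (fun t => h 0 t - k * h 2 t) (p 2) :=
    ((hs 0).contDiffAt hT).continuousAt.sub
      (continuousAt_const.mul ((hs 2).contDiffAt hT).continuousAt)
  have hlin : ContDiff ℝ ∞ fun t : ℝ => k * t := contDiff_const.mul contDiff_id
  obtain ⟨φ, hφ, hφ'⟩ := exists_contDiff_antiderivative hlin.exp
  have hφ'' : ∀ t, deriv (deriv φ) t = Real.exp (k * t) * k := fun t => by
    rw [hφ']
    simpa using (((hasDerivAt_id t).const_mul k).exp).deriv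
  have hF : ContDiff ℝ ∞ fun _ : ℝ => (0 : ℝ) := contDiff_const
  have hA : ContDiff ℝ ∞ fun _ : ℝ => (1 : ℝ) := contDiff_const
  obtain ⟨Φ, τ, hΦ, hpΦ, hΦV, hsrc, htgt, hsymm, hτ⟩ := exists_shear hV hp
    (Filter.inter_mem hT (hkc.eventually_ne hk2)) hφ hF
    (by rw [hφ']; exact (Real.exp_pos _).ne')
  have hmaps : ∀ s ∈ thirdRange Φ.target,
      τ s ∈ thirdRange V ∧ h 0 (τ s) - k * h 2 (τ s) ≠ 0 := by
    rw [htgt]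
    rintro _ ⟨t, ht, rfl⟩
    rw [(hsrc t ht).2.2]
    exact (hsrc t ht).1
  have hsτ : ∀ i, ContDiffOn ℝ ∞ (fun s => h i (τ s)) (thirdRange Φ.target) := fun i =>
    (hs i).comp hτ fun s hs => (hmaps s hs).1
  have hE : ContDiffOn ℝ ∞ (fun s => Real.exp (-(k * τ s))) (thirdRange Φ.target) :=
    hlin.neg.exp.comp_contDiffOn hτ
  let a : NFParams :=
    { b := 0
      e21 := fun s => -k * Real.exp (-(k * τ s)) ^ 2
      e31 := fun s => -k * h 1 (τ s) * Real.exp (-(k * τ s))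
      e32 := fun s => (h 0 (τ s) - k * h 2 (τ s)) * Real.exp (-(k * τ s))
      c21 := fun s => Real.exp (-(k * τ s))
      c31 := fun s => h 1 (τ s)
      c32 := fun s => h 2 (τ s) }
  have hX : OpEqOn V (normalForm (reduced h) + lie (0 : VField) P0) (normalForm (reduced h)) := by
    intro u ξ _ _
    have h0 : lie (0 : VField) P0 u ξ = 0 := by
      have hadj : VField.linAdj 0 u ξ = 0 := by
        funext x j
        simp [VField.linAdj, VField.partialD]
      funext x i
      rw [lie_P0_apply, hadj]
      fin_cases i <;> simp [VField.lin, VField.partialD, P0]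
    have h1 : (normalForm (reduced h) + lie (0 : VField) P0) u ξ
        = normalForm (reduced h) u ξ + lie (0 : VField) P0 u ξ := rfl
    rw [h1, h0, add_zero]
  refine ⟨Φ, a, hpΦ, hΦV, ?_, fun _ _ => rfl, ?_,
    isMiura_of_shear hV contDiffOn_const hX hA hΦ hφ hF hΦV hsymm ?_⟩
  · simp only [NFParams.SmoothOn, List.mem_cons, List.not_mem_nil, or_false, forall_eq_or_imp,
      forall_eq]
    exact ⟨contDiffOn_const, contDiffOn_const.mul (hE.pow 2),
      (contDiffOn_const.mul (hsτ 1)).mul hE,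
      ((hsτ 0).sub (contDiffOn_const.mul (hsτ 2))).mul hE, hE, hsτ 1, hsτ 2⟩
  · simp only [NFParams.GenericOn, List.mem_cons, List.not_mem_nil, or_false, forall_eq_or_imp,
      forall_eq]
    have hexp : ∀ s, Real.exp (-(k * τ s)) ≠ 0 := fun s => (Real.exp_pos _).ne'
    exact ⟨fun s _ => mul_ne_zero (neg_ne_zero.2 hk) (pow_ne_zero _ (hexp s)),
      fun s hs => mul_ne_zero (mul_ne_zero (neg_ne_zero.2 hk) (hne _ (hmaps s hs).1).1) (hexp s),
      fun s hs => mul_ne_zero (hmaps s hs).2 (hexp s), fun s _ => hexp s,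
      fun s hs => (hne _ (hmaps s hs).1).1, fun s hs => (hne _ (hmaps s hs).1).2⟩
  refine isTransform_normalForm_shear hΦ hφ hF (fun _ _ => rfl) (fun _ _ => rfl) ?_ ?_ ?_ ?_ ?_ ?_
    <;> intro t ht <;> have hτt := (hsrc t ht).2.2
  · simp [reduced, a, hτt]
  · simp [reduced, a, hτt]
  · simp [reduced, a, hτt, hφ', ← Real.exp_add]
  · rw [hφ'']
    simp only [reduced, a, hτt, hφ', Real.exp_neg, Pi.zero_apply]
    field_simp
    ring
  · rw [hφ'']
    simp only [reduced, a, hτt, hφ', Real.exp_neg]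
    field_simp
    ring
  · rw [hφ'']
    simp only [reduced, a, hτt, hφ', Real.exp_neg, Pi.zero_apply, Pi.add_apply,
      deriv_const]
    field_simp
    ring

/-! ### Rigidity of the reduced normal forms -/

/-- The point of the line through `p` parallel to the `u³`-axis with third coordinate `t`. -/
def axisLine (p : E3) (t : ℝ) : E3 := ![p 0, p 1, t]

theorem axisLine_self (p : E3) : axisLine p (p 2) = p := by
  ext i
  fin_cases i <;> rfl

theorem hasDerivAt_axisLine (p : E3) (t : ℝ) :
    HasDerivAt (axisLine p) (Pi.single 2 1) t := by
  refine hasDerivAt_pi.2 fun i => ?_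
  fin_cases i
  · exact hasDerivAt_const t (p 0)
  · exact hasDerivAt_const t (p 1)
  · exact hasDerivAt_id t

theorem contDiff_axisLine (p : E3) : ContDiff ℝ ∞ (axisLine p) := by
  refine contDiff_pi.2 fun i => ?_
  fin_cases i
  · exact contDiff_const
  · exact contDiff_const
  · exact contDiff_id

/-- `J diag(1, 1, 0) Jᵗ = diag(1, 1, 0)` for the Jacobian of a transformation preserving `P0`. -/
theorem jacobian_orthogonality {Φ : OpenPartialHomeomorph E3 E3} (h : IsTransform Φ P0 P0)
    {q : E3} (hq : q ∈ Φ.source) (i j : Fin 3) :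
    jacobian Φ q i 0 * jacobian Φ q j 0 + jacobian Φ q i 1 * jacobian Φ q j 1
      = if i = j ∧ i ≠ 2 then 1 else 0 := by
  have hd : ∀ v : E3, deriv (fun y : ℝ => y • v) 0 = v := fun v => by
    simpa using ((hasDerivAt_id (0 : ℝ)).smul_const v).deriv
  have h1 := congrFun (congrFun (h (fun _ => q) (fun y => y • Pi.single j 1)
    ⟨contDiff_const, fun _ => hq⟩ (contDiff_id.smul contDiff_const)) 0) i
  simp only [Matrix.mulVec_smul, P0, hd] at h1
  simp only [Matrix.mulVec, dotProduct, Fin.sum_univ_three, Matrix.transpose_apply,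
    Matrix.cons_val, mul_zero, add_zero] at h1
  have h2 : jacobian Φ q i 0 * jacobian Φ q j 0 + jacobian Φ q i 1 * jacobian Φ q j 1
      = ![(Pi.single j 1 : E3) 0, (Pi.single j 1 : E3) 1, 0] i := by
    rw [h1]
    fin_cases j <;> simp
  rw [h2]
  fin_cases i <;> fin_cases j <;> simp

/-- The entries of the orthogonal block of the Jacobian are constant along every field. -/
theorem deriv_jacobian_block {Φ : OpenPartialHomeomorph E3 E3}
    (hΦ : ContDiffOn ℝ ∞ Φ Φ.source) (h : IsTransform Φ P0 P0) {u : ℝ → E3}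
    (hu : IsField Φ.source u) {j : Fin 3} (x : ℝ) :
    deriv (fun y => jacobian Φ (u y) j 0) x = 0 ∧ deriv (fun y => jacobian Φ (u y) j 1) x = 0 := by
  have hη := contDiff_jacobian_transpose_mulVec hΦ hu
    (ξ := fun _ => Pi.single j 1) contDiff_const
  have hη' := fun k => deriv_apply (hη.differentiable (by simp) x) k
  have hP := congrFun (h u (fun _ => Pi.single j 1) hu contDiff_const) x
  simp only [P0, hη'] at hP
  simp only [Matrix.mulVec_single_one, Matrix.col_apply, Matrix.transpose_apply, deriv_const,
    Pi.zero_apply] at hP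
  have h0 := congrFun hP 0
  have h1 := congrFun hP 1
  simp only [Matrix.mulVec, dotProduct, Fin.sum_univ_three, Matrix.cons_val, mul_zero,
    add_zero] at h0 h1
  have o := jacobian_orthogonality h (hu.2 x)
  have o00 := o 0 0
  have o01 := o 0 1
  have o11 := o 1 1
  simp at o00 o01 o11
  set R := jacobian Φ (u x)
  -- By orthogonality the block is invertible, so it may be cancelled from `R (Rᵗ)_x = 0`.
  have hdet : R 0 0 * R 1 1 - R 0 1 * R 1 0 ≠ 0 := by
    intro hz
    have : (R 0 0 * R 1 1 - R 0 1 * R 1 0) ^ 2 = 1 := by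
      linear_combination o11 * (R 0 0 * R 0 0 + R 0 1 * R 0 1) + o00
        - o01 * (R 0 0 * R 1 0 + R 0 1 * R 1 1)
    rw [hz] at this
    norm_num at this
  constructor <;> refine (mul_eq_zero.1 ?_).resolve_left hdet
  · linear_combination R 0 1 * h1 - R 1 1 * h0
  · linear_combination R 1 0 * h0 - R 0 0 * h1

/-- The third component of a transformed operator on a constant covector `e_i`: the Lie derivative
does not contribute. -/
theorem miura_third_component {Φ : OpenPartialHomeomorph E3 E3} {P₁ Q₁ : Op}
    (hM : IsMiura Φ P₁ Q₁) {u : ℝ → E3} (hu : IsField Φ.source u) (i : Fin 3) (x : ℝ) :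
    Q₁ (fun x => Φ (u x)) (fun _ => Pi.single i 1) x 2
      = jacobian Φ (u x) 2 2 * P₁ u (fun y => jacobian Φ (u y) i) x 2 := by
  obtain ⟨X, hX, hT⟩ := hM.first
  have hη := contDiff_jacobian_transpose_mulVec hM.smooth hu
    (ξ := fun _ => Pi.single i 1) contDiff_const
  have hrow : ∀ y, (jacobian Φ (u y))ᵀ *ᵥ Pi.single i 1 = jacobian Φ (u y) i := fun y => by
    rw [Matrix.mulVec_single_one]
    rfl
  simp only [hrow] at hη
  have hP0 : P0 u (fun y => jacobian Φ (u y) i) = 0 := by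
    funext y
    have hd := deriv_jacobian_block hM.smooth hM.leading hu (j := i) y
    have hd' := fun k => deriv_apply (hη.differentiable (by simp) y) k
    ext k
    fin_cases k <;> simp [P0, hd', hd]
  have hlie : lie X P0 u (fun y => jacobian Φ (u y) i) x 2 = 0 := by
    rw [lie_P0_apply, hP0]
    simp [VField.lin, P0]
  have h22 := jacobian_orthogonality hM.leading (hu.2 x) 2 2
  simp only [ne_eq, not_true_eq_false, and_false, if_false] at h22
  have h20 : jacobian Φ (u x) 2 0 = 0 := by nlinarith
  have h21 : jacobian Φ (u x) 2 1 = 0 := by nlinarith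
  have := congrFun (congrFun (hT u (fun _ => Pi.single i 1) hu contDiff_const) x) 2
  simp only [hrow] at this
  rw [this]
  simp only [Matrix.mulVec, dotProduct, Fin.sum_univ_three, h20, h21, Pi.add_apply, hlie]
  ring

theorem IsMiura.jacobian_third_ne_zero {Φ : OpenPartialHomeomorph E3 E3} {P₁ Q₁ : Op}
    (hM : IsMiura Φ P₁ Q₁) {q : E3} (hq : q ∈ Φ.source) : jacobian Φ q 2 2 ≠ 0 := by
  intro hz
  have h22 := jacobian_orthogonality hM.leading hq 2 2
  simp only [ne_eq, not_true_eq_false, and_false, if_false] at h22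
  have h20 : jacobian Φ q 2 0 = 0 := by nlinarith
  have h21 : jacobian Φ q 2 1 = 0 := by nlinarith
  have hrow : ∀ k, fderiv ℝ Φ q (Pi.single k 1) 2 = 0 := by
    intro k
    fin_cases k
    exacts [h20, h21, hz]
  have hall : ∀ w : E3, fderiv ℝ Φ q w 2 = 0 := by
    intro w
    rw [pi_eq_sum_univ' w, map_sum, Finset.sum_apply]
    refine Finset.sum_eq_zero fun k _ => ?_
    rw [map_smul, Pi.smul_apply]
    simp [hrow]
  have h1 : DifferentiableAt ℝ Φ (Φ.symm (Φ q)) := by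
    rw [Φ.left_inv hq]
    exact (hM.smooth.contDiffAt (Φ.open_source.mem_nhds hq)).differentiableAt (by simp)
  have h2 := (hM.smooth_symm.contDiffAt
    (Φ.open_target.mem_nhds (Φ.map_source hq))).differentiableAt (by simp)
  have h3 : HasFDerivAt (Φ ∘ Φ.symm) (ContinuousLinearMap.id ℝ E3) (Φ q) :=
    (hasFDerivAt_id _).congr_of_eventuallyEq
      (Φ.eventually_right_inverse (Φ.map_source hq))
  have h4 := (h1.hasFDerivAt.comp _ h2.hasFDerivAt).unique h3
  rw [Φ.left_inv hq] at h4
  have h5 := congrFun (congrArg (fun L : E3 →L[ℝ] E3 => L (Pi.single 2 1)) h4) 2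
  simp [hall] at h5

/-- The relations which a Miura transformation between reduced normal forms imposes on the
third component `φ` of its leading term along a line parallel to the `u³`-axis. Only the values at
`p` of the Jacobian enter as constants. -/
theorem reduced_relations {Φ : OpenPartialHomeomorph E3 E3} {h f : Fin 3 → ℝ → ℝ}
    (hM : IsMiura Φ (normalForm (reduced h)) (normalForm (reduced f))) {p : E3} {r : ℝ}
    (hr : ∀ t ∈ Metric.ball (p 2) r, axisLine p t ∈ Φ.source) {φ : ℝ → ℝ}
    (hφ : φ = fun t => Φ (axisLine p t) 2) {t : ℝ} (ht : t ∈ Metric.ball (p 2) r) :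
    ContDiffAt ℝ ∞ φ t ∧ deriv φ t = jacobian Φ (axisLine p t) 2 2 ∧ deriv φ t ≠ 0 ∧
      f 1 (φ t) = h 1 t * jacobian Φ p 0 0 + h 2 t * jacobian Φ p 0 1 ∧
      f 2 (φ t) = h 1 t * jacobian Φ p 1 0 + h 2 t * jacobian Φ p 1 1 ∧
      f 1 (φ t) * deriv (deriv φ) t = deriv φ t * (h 0 t * jacobian Φ p 0 1) ∧
      f 0 (φ t) * deriv φ t ^ 2 + f 2 (φ t) * deriv (deriv φ) t
        = deriv φ t * (h 0 t * jacobian Φ p 1 1) := by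
  have hsm : ∀ s ∈ Metric.ball (p 2) r, ContDiffAt ℝ ∞ φ s := by
    intro s hs
    rw [hφ]
    have h1 := (hM.smooth.contDiffAt (Φ.open_source.mem_nhds (hr s hs))).comp s
      (contDiff_axisLine p).contDiffAt
    exact contDiffAt_pi.1 h1 2
  have hder : ∀ s ∈ Metric.ball (p 2) r, deriv φ s = jacobian Φ (axisLine p s) 2 2 := by
    intro s hs
    have h1 := ((hM.smooth.contDiffAt (Φ.open_source.mem_nhds (hr s hs))).differentiableAt
      (by simp)).hasFDerivAt.comp_hasDerivAt s (hasDerivAt_axisLine p s)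
    rw [hφ]
    exact (hasDerivAt_pi.1 h1 2).deriv
  have hne : deriv φ t ≠ 0 := by
    rw [hder t ht]
    exact hM.jacobian_third_ne_zero (hr t ht)
  have hfield : ∀ {σ : ℝ → ℝ}, ContDiff ℝ ∞ σ → (∀ x, σ x ∈ Metric.ball (p 2) r) →
      IsField Φ.source fun x => axisLine p (σ x) := fun hσ hmem =>
    ⟨(contDiff_axisLine p).comp hσ, fun x => hr _ (hmem x)⟩
  -- A field running back and forth on the line from `p` shows that the block is constant there.
  have hblock : ∀ s ∈ Metric.ball (p 2) r, ∀ j,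
      jacobian Φ (axisLine p s) j 0 = jacobian Φ p j 0 ∧
        jacobian Φ (axisLine p s) j 1 = jacobian Φ p j 1 := by
    intro s hs j
    have hσ : ContDiff ℝ ∞ fun x => p 2 + (s - p 2) * Real.sin x :=
      contDiff_const.add (contDiff_const.mul Real.contDiff_sin)
    have hu := hfield hσ fun x => by
      rw [Metric.mem_ball, Real.dist_eq] at hs ⊢
      rw [add_sub_cancel_left, abs_mul]
      exact (mul_le_of_le_one_right (abs_nonneg _) (Real.abs_sin_le_one x)).trans_lt hs
    have hd := fun x => deriv_jacobian_block hM.smooth hM.leading hu (j := j) x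
    have hsmooth := contDiff_jacobian_transpose_mulVec hM.smooth hu
      (ξ := fun _ => Pi.single j 1) contDiff_const
    have hk : ∀ k, Differentiable ℝ fun x =>
        jacobian Φ (axisLine p (p 2 + (s - p 2) * Real.sin x)) j k := fun k => by
      have := (contDiff_component hsmooth k).differentiable (by simp)
      simpa only [Matrix.mulVec_single_one, Matrix.col_apply, Matrix.transpose_apply] using this
    have c0 := is_const_of_deriv_eq_zero (hk 0) (fun x => (hd x).1) (Real.pi / 2) 0
    have c1 := is_const_of_deriv_eq_zero (hk 1) (fun x => (hd x).2) (Real.pi / 2) 0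
    simp only [Real.sin_pi_div_two, Real.sin_zero, mul_one, mul_zero, add_zero,
      add_sub_cancel, axisLine_self] at c0 c1
    exact ⟨c0, c1⟩
  have key : ∀ {σ : ℝ → ℝ}, ContDiff ℝ ∞ σ → (∀ x, σ x ∈ Metric.ball (p 2) r) → σ 0 = t →
      f 1 (φ t) * (deriv (deriv φ) t * deriv σ 0 ^ 2 + deriv φ t * deriv (deriv σ) 0)
        = deriv φ t * (h 1 t * deriv (deriv σ) 0 * jacobian Φ p 0 0
          + (h 0 t * deriv σ 0 ^ 2 + h 2 t * deriv (deriv σ) 0) * jacobian Φ p 0 1) ∧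
      f 0 (φ t) * deriv φ t ^ 2 * deriv σ 0 ^ 2
          + f 2 (φ t) * (deriv (deriv φ) t * deriv σ 0 ^ 2 + deriv φ t * deriv (deriv σ) 0)
        = deriv φ t * (h 1 t * deriv (deriv σ) 0 * jacobian Φ p 1 0
          + (h 0 t * deriv σ 0 ^ 2 + h 2 t * deriv (deriv σ) 0) * jacobian Φ p 1 1) := by
    intro σ hσ hmem hσ0
    have hu := hfield hσ hmem
    have hv : ContDiff ℝ ∞ fun x => Φ (axisLine p (σ x)) := contDiff_comp_field hM.smooth hu
    have hg := fun e c => gam_comp hu.1 hv (fun x => hsm _ (hmem x))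
      (fun x => by rw [hφ]; rfl) e c 0
    have hg' := fun e c => gam_eq hu.1 e c 0
    have hcomp : (fun y => axisLine p (σ y) 2) = σ := rfl
    have hcomp0 : axisLine p (σ 0) 2 = t := hσ0
    simp only [hcomp, hcomp0] at hg hg'
    have hb := hblock t ht
    have m0 := miura_third_component hM hu 0 0
    have m1 := miura_third_component hM hu 1 0
    rw [normalForm_of_b_eq_zero fun _ => rfl, normalForm_of_b_eq_zero fun _ => rfl] at m0 m1
    simp only [hσ0, ← hder t ht, hb, hg, hg', reduced, Matrix.cons_val, Pi.single_apply,
      Pi.zero_apply] at m0 m1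
    norm_num at m0 m1
    exact ⟨by linear_combination m0, by linear_combination m1⟩
  obtain ⟨δ, hδ, hδr⟩ : ∃ δ > 0, dist t (p 2) + 2 * δ < r := by
    rw [Metric.mem_ball] at ht
    exact ⟨(r - dist t (p 2)) / 4, by linarith, by linarith⟩
  have hnear : ∀ {s : ℝ}, |s - t| ≤ 2 * δ → s ∈ Metric.ball (p 2) r := fun {s} hs => by
    rw [Metric.mem_ball]
    have h1 := dist_triangle s t (p 2)
    rw [Real.dist_eq s t] at h1
    linarith
  -- The two fields `t + δ sin x` and `t + δ cos x - δ` separate `(u³_x)²` from `u³_{xx}` at `0`.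
  have d1 : deriv (fun x => t + δ * Real.sin x) = fun x => δ * Real.cos x := by
    funext x
    simp
  have d2 : deriv (fun x => t + (δ * Real.cos x - δ)) = fun x => δ * -Real.sin x := by
    funext x
    exact ((((Real.hasDerivAt_cos x).const_mul δ).sub_const δ).const_add t).deriv
  have dd1 : deriv (fun x => δ * Real.cos x) 0 = 0 := by
    simp
  have dd2 : deriv (fun x => δ * -Real.sin x) 0 = -δ := by
    simp
  obtain ⟨a0, a1⟩ := key (σ := fun x => t + δ * Real.sin x)
    (contDiff_const.add (contDiff_const.mul Real.contDiff_sin))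
    (fun x => hnear (by
      rw [add_sub_cancel_left, abs_mul, abs_of_pos hδ]
      nlinarith [Real.abs_sin_le_one x])) (by simp)
  obtain ⟨b0, b1⟩ := key (σ := fun x => t + (δ * Real.cos x - δ))
    (contDiff_const.add ((contDiff_const.mul Real.contDiff_cos).sub contDiff_const))
    (fun x => hnear (by
      rw [add_sub_cancel_left, abs_le]
      constructor <;> nlinarith [Real.neg_one_le_cos x, Real.cos_le_one x])) (by simp)
  rw [d1, dd1] at a0 a1
  rw [d2, dd2] at b0 b1
  simp only [Real.cos_zero, Real.sin_zero, mul_one, mul_zero, neg_zero, add_zero, zero_add,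
    zero_mul, ne_eq, OfNat.ofNat_ne_zero, not_false_eq_true, zero_pow] at a0 a1 b0 b1
  have hδ2 : δ ^ 2 ≠ 0 := pow_ne_zero _ hδ.ne'
  refine ⟨hsm t ht, hder t ht, hne, ?_, ?_, ?_, ?_⟩
  · refine mul_right_cancel₀ (mul_ne_zero hne hδ.ne') ?_
    linear_combination -b0
  · refine mul_right_cancel₀ (mul_ne_zero hne hδ.ne') ?_
    linear_combination -b1
  · refine mul_right_cancel₀ hδ2 ?_
    linear_combination a0
  · refine mul_right_cancel₀ hδ2 ?_
    linear_combination a1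

/-- Uniqueness for the equation `κ φ'' = ρ φ'` near a point where `κ ≠ 0`. -/
theorem eqOn_of_second_order {φ ψ κ ρ : ℝ → ℝ} {c r : ℝ}
    (hφ : ∀ t ∈ Metric.ball c r, ContDiffAt ℝ ∞ φ t)
    (hψ : ∀ t ∈ Metric.ball c r, ContDiffAt ℝ ∞ ψ t)
    (hψ' : ∀ t ∈ Metric.ball c r, deriv ψ t ≠ 0) (hκ : ∀ t ∈ Metric.ball c r, κ t ≠ 0)
    (eφ : ∀ t ∈ Metric.ball c r, κ t * deriv (deriv φ) t = deriv φ t * ρ t)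
    (eψ : ∀ t ∈ Metric.ball c r, κ t * deriv (deriv ψ) t = deriv ψ t * ρ t)
    (h0 : φ c = ψ c) (h1 : deriv φ c = deriv ψ c) :
    ∀ t ∈ Metric.ball c r, φ t = ψ t ∧ deriv φ t = deriv ψ t := by
  intro t ht
  have hc : c ∈ Metric.ball c r := Metric.mem_ball_self (dist_nonneg.trans_lt ht)
  have hpre := (convex_ball c r).isPreconnected
  have hd : ∀ {χ : ℝ → ℝ} {s : ℝ}, ContDiffAt ℝ ∞ χ s → DifferentiableAt ℝ (deriv χ) s :=
    fun {χ s} hχ => by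
      have : ContDiffAt ℝ ∞ (deriv χ) s :=
        (hχ.fderiv_right (m := ∞) (by simp)).clm_apply contDiffAt_const
      exact this.differentiableAt (by simp)
  have hq : ∀ s ∈ Metric.ball c r, HasDerivAt (fun s => deriv φ s / deriv ψ s) 0 s := by
    intro s hs
    refine ((hd (hφ s hs)).hasDerivAt.fun_div (hd (hψ s hs)).hasDerivAt (hψ' s hs)).congr_deriv ?_
    rw [div_eq_zero_iff]
    left
    refine mul_left_cancel₀ (hκ s hs) ?_
    linear_combination deriv ψ s * eφ s hs - deriv φ s * eψ s hs
  have hderiv : ∀ s ∈ Metric.ball c r, deriv φ s = deriv ψ s := by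
    intro s hs
    have := Metric.isOpen_ball.is_const_of_deriv_eq_zero hpre
      (fun s hs => (hq s hs).differentiableAt.differentiableWithinAt)
      (fun s hs => (hq s hs).deriv) hs hc
    rw [h1, div_self (hψ' c hc)] at this
    exact (div_eq_one_iff_eq (hψ' s hs)).1 this
  refine ⟨Metric.isOpen_ball.eqOn_of_deriv_eq hpre
    (fun s hs => ((hφ s hs).differentiableAt (by simp)).differentiableWithinAt)
    (fun s hs => ((hψ s hs).differentiableAt (by simp)).differentiableWithinAt)
    hderiv hc h0 ht, hderiv t ht⟩

theorem reduced_rigidity {Φ Ψ : OpenPartialHomeomorph E3 E3} {h f g : Fin 3 → ℝ → ℝ} {p : E3}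
    (hpΦ : p ∈ Φ.source) (hpΨ : p ∈ Ψ.source) (hf : Admissible f Φ.target)
    (hMΦ : IsMiura Φ (normalForm (reduced h)) (normalForm (reduced f)))
    (hMΨ : IsMiura Ψ (normalForm (reduced h)) (normalForm (reduced g)))
    (h0 : Φ p = Ψ p) (h1 : fderiv ℝ Φ p = fderiv ℝ Ψ p) (i : Fin 3) :
    f i =ᶠ[𝓝 (Φ p 2)] g i := by
  obtain ⟨r, hr, hball⟩ : ∃ r > 0, ∀ t ∈ Metric.ball (p 2) r,
      axisLine p t ∈ Φ.source ∩ Ψ.source := by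
    have hopen := (Φ.open_source.inter Ψ.open_source).preimage (contDiff_axisLine p).continuous
    have hmem : p 2 ∈ axisLine p ⁻¹' (Φ.source ∩ Ψ.source) := by
      rw [Set.mem_preimage, axisLine_self]
      exact ⟨hpΦ, hpΨ⟩
    exact Metric.isOpen_iff.1 hopen _ hmem
  have hp := Metric.mem_ball_self (x := p 2) hr
  have hJ : jacobian Φ p = jacobian Ψ p := by simp only [jacobian, h1]
  obtain ⟨φ, hφ⟩ : ∃ φ : ℝ → ℝ, φ = fun t => Φ (axisLine p t) 2 := ⟨_, rfl⟩
  obtain ⟨ψ, hψ⟩ : ∃ ψ : ℝ → ℝ, ψ = fun t => Ψ (axisLine p t) 2 := ⟨_, rfl⟩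
  have rφ := fun t ht => reduced_relations hMΦ (fun t ht => (hball t ht).1) hφ (t := t) ht
  have rψ := fun t ht => reduced_relations hMΨ (fun t ht => (hball t ht).2) hψ (t := t) ht
  rw [← hJ] at rψ
  have hfne : ∀ t ∈ Metric.ball (p 2) r, f 1 (φ t) ≠ 0 := fun t ht =>
    (hf.2 _ ⟨_, Φ.map_source (hball t ht).1, by rw [hφ]⟩).1
  have hfg1 : ∀ t ∈ Metric.ball (p 2) r, f 1 (φ t) = g 1 (ψ t) := fun t ht => by
    rw [(rφ t ht).2.2.2.1, (rψ t ht).2.2.2.1]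
  have hφp : φ (p 2) = Φ p 2 := by simp only [hφ, axisLine_self]
  have huniq := eqOn_of_second_order (fun t ht => (rφ t ht).1) (fun t ht => (rψ t ht).1)
    (fun t ht => (rψ t ht).2.2.1) hfne (fun t ht => (rφ t ht).2.2.2.2.2.1)
    (fun t ht => by rw [hfg1 t ht]; exact (rψ t ht).2.2.2.2.2.1)
    (by rw [hφp, h0, hψ]; simp only [axisLine_self])
    (by rw [(rφ _ hp).2.1, (rψ _ hp).2.1, axisLine_self, hJ])
  have hfg : ∀ t ∈ Metric.ball (p 2) r, f i (φ t) = g i (φ t) := by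
    intro t ht
    obtain ⟨-, -, hne, -, e2, e3, e4⟩ := rφ t ht
    obtain ⟨-, -, -, -, e2', e3', e4'⟩ := rψ t ht
    obtain ⟨u0, u1⟩ := huniq t ht
    have hfg2 : f 2 (φ t) = g 2 (ψ t) := by rw [e2, e2']
    rw [← hfg1 t ht, ← u1, ← e3] at e3'
    have u2 := mul_left_cancel₀ (hfne t ht) e3'
    fin_cases i
    · refine mul_right_cancel₀ (pow_ne_zero 2 hne) ?_
      change f 0 (φ t) * _ = g 0 (φ t) * _
      rw [← hfg2, ← u0, ← u1, u2] at e4'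
      linear_combination e4 - e4'
    · change f 1 (φ t) = g 1 (φ t)
      rw [hfg1 t ht, u0]
    · change f 2 (φ t) = g 2 (φ t)
      rw [hfg2, u0]
  have hstrict := (rφ _ hp).1.hasStrictDerivAt (by simp)
  rw [← hφp, ← hstrict.map_nhds_eq (rφ _ hp).2.2.1]
  exact Filter.eventually_map.2
    (Filter.eventually_of_mem (Metric.ball_mem_nhds _ hr) hfg)

end DegPoisson

theorem mainTheorem10 :
    -- every generic deformation with `b = 0` reduces to a normal form with three functions of `u³`
    (∀ (U : Set DegPoisson.E3) (P₁ : DegPoisson.Op) (a : DegPoisson.NFParams),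
      IsOpen U → DegPoisson.IsDeformation U P₁ →
      a.SmoothOn U → (∀ t ∈ DegPoisson.thirdRange U, a.b t = 0) → a.GenericOn U →
      DegPoisson.InfMiuraEquiv U P₁ (DegPoisson.normalForm a) →
      ∀ p ∈ U, ∃ (Φ : OpenPartialHomeomorph DegPoisson.E3 DegPoisson.E3) (h : Fin 3 → ℝ → ℝ),
        p ∈ Φ.source ∧ Φ.source ⊆ U ∧ DegPoisson.Admissible h Φ.target ∧
        DegPoisson.IsMiura Φ P₁ (DegPoisson.normalForm (DegPoisson.reduced h))) ∧
    -- the three functions are arbitrary: all of these normal forms are deformations, and locally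
    -- they come from generic deformations with `b = 0`
    (∀ (V : Set DegPoisson.E3) (h : Fin 3 → ℝ → ℝ),
      IsOpen V → DegPoisson.Admissible h V →
      DegPoisson.IsDeformation V (DegPoisson.normalForm (DegPoisson.reduced h)) ∧
      ∀ q ∈ V, ∃ (Φ : OpenPartialHomeomorph DegPoisson.E3 DegPoisson.E3)
          (a : DegPoisson.NFParams),
        q ∈ Φ.source ∧ Φ.source ⊆ V ∧ a.SmoothOn Φ.target ∧
        (∀ t ∈ DegPoisson.thirdRange Φ.target, a.b t = 0) ∧ a.GenericOn Φ.target ∧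
        DegPoisson.IsMiura Φ (DegPoisson.normalForm (DegPoisson.reduced h))
          (DegPoisson.normalForm a)) ∧
    -- the three functions are essential: a Miura transformation between two such normal forms acts
    -- on them only through the first jet of its leading term at a point (finitely many constants)
    (∀ (Φ Ψ : OpenPartialHomeomorph DegPoisson.E3 DegPoisson.E3) (h f g : Fin 3 → ℝ → ℝ)
        (p : DegPoisson.E3),
      p ∈ Φ.source → p ∈ Ψ.source →
      DegPoisson.Admissible h Φ.source → DegPoisson.Admissible h Ψ.source →
      DegPoisson.Admissible f Φ.target → DegPoisson.Admissible g Ψ.target →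
      DegPoisson.IsMiura Φ (DegPoisson.normalForm (DegPoisson.reduced h))
        (DegPoisson.normalForm (DegPoisson.reduced f)) →
      DegPoisson.IsMiura Ψ (DegPoisson.normalForm (DegPoisson.reduced h))
        (DegPoisson.normalForm (DegPoisson.reduced g)) →
      Φ p = Ψ p → fderiv ℝ Φ p = fderiv ℝ Ψ p →
      ∀ i, f i =ᶠ[𝓝 (Φ p 2)] g i) := by
  refine ⟨?_, ?_, ?_⟩
  · intro U P₁ a hU _ ha hb hgen hP p hp
    simp only [DegPoisson.NFParams.GenericOn, List.mem_cons, List.not_mem_nil, or_false,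
      forall_eq_or_imp, forall_eq] at hgen
    exact DegPoisson.exists_isMiura_reduced hU ha hb hgen.2.2.2.2.1 hgen.2.2.2.2.2 hP hp
  · intro V h hV hh
    exact ⟨DegPoisson.isDeformation_normalForm_reduced hh.1,
      fun q hq => DegPoisson.exists_isMiura_generic hV hh hq⟩
  · intro Φ Ψ h f g p hpΦ hpΨ _ _ hf _ hMΦ hMΨ h0 h1 i
    exact DegPoisson.reduced_rigidity hpΦ hpΨ hf hMΦ hMΨ h0 h1 i
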